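/- Let $n\ge 1$, let $(M,g)$ be either the round unit sphere $\mathbb S^n\subset\mathbb R^{n+1}$ or the flat torus $\mathbb T^n=\mathbb R^n/(2\pi\mathbb Z)^n$, let $\Delta=\operatorname{div}\circ\nabla$ be its Laplace–Beltrami operator, let $\Lambda>0$ be an eigenvalue of $-\Delta$, and let $$\mathcal E_\Lambda=\{f\in C^\infty(M,\mathbb R):\ -\Delta f=\Lambda f\}$$ be the corresponding (nonzero) eigenspace. Call the nodal set $f^{-1}(0)$ of $f\in\mathcal E_\Lambda$ regular if $0$ is a regular value of $f$, i.e. $\nabla f(x)\neq 0$ at every point $x$ with $f(x)=0$. Then, for every integer $r\ge 1$, the set of those $f\in\mathcal E_\Lambda$ whose nodal set is regular is open and dense in $\mathcal E_\Lambda$ with respect to the $C^r$ topology. -/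

import Mathlib

open scoped Manifold ContDiff InnerProductSpace Topology

noncomputable section

/-! ### Laplace–Beltrami operator, eigenspaces and the `C^r` topology on a Riemannian manifold -/

section Riemannian

variable {n : ℕ} {M : Type*} [TopologicalSpace M] [ChartedSpace (EuclideanSpace ℝ (Fin n)) M]

/-- The `i`-th standard basis vector of `ℝ^n`, as a tangent vector at `y`. -/
def basisVector {n : ℕ} (y : EuclideanSpace ℝ (Fin n)) (i : Fin n) : TangentSpace (𝓡 n) y :=
  EuclideanSpace.single i (1 : ℝ)

/-- The matrix `g_{ij} = g(∂_i, ∂_j)` of the metric `g` in the chart `φ = chartAt x`, at the point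
with coordinates `y`. -/
def metricMatrix (g : Bundle.RiemannianMetric (fun p : M => TangentSpace (𝓡 n) p)) (x : M)
    (y : EuclideanSpace ℝ (Fin n)) : Matrix (Fin n) (Fin n) ℝ :=
  let φ := chartAt (EuclideanSpace ℝ (Fin n)) x
  Matrix.of fun i j =>
    g.inner (φ.symm y)
      (mfderiv (𝓡 n) (𝓡 n) φ.symm y (basisVector y i))
      (mfderiv (𝓡 n) (𝓡 n) φ.symm y (basisVector y j))

/-- The volume density `√(det g_{ij})` in the chart `chartAt x`. -/
def volumeDensity (g : Bundle.RiemannianMetric (fun p : M => TangentSpace (𝓡 n) p)) (x : M)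
    (y : EuclideanSpace ℝ (Fin n)) : ℝ :=
  √(metricMatrix g x y).det

/-- The components `(∇f)^i = ∑_j g^{ij} ∂_j f` of the gradient in the chart `chartAt x`. -/
def gradientComponent (g : Bundle.RiemannianMetric (fun p : M => TangentSpace (𝓡 n) p))
    (f : M → ℝ) (x : M) (i : Fin n) (y : EuclideanSpace ℝ (Fin n)) : ℝ :=
  ∑ j, (metricMatrix g x y)⁻¹ i j *
    fderiv ℝ (f ∘ (chartAt (EuclideanSpace ℝ (Fin n)) x).symm) y (EuclideanSpace.single j (1 : ℝ))

/-- The Laplace–Beltrami operator `Δ f = div (∇ f)`, where, in coordinates,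
`div X = (det g)^{-1/2} ∑_i ∂_i ((det g)^{1/2} X^i)`. -/
def laplaceBeltrami (g : Bundle.RiemannianMetric (fun p : M => TangentSpace (𝓡 n) p))
    (f : M → ℝ) (x : M) : ℝ :=
  let y₀ := chartAt (EuclideanSpace ℝ (Fin n)) x x
  (volumeDensity g x y₀)⁻¹ *
    ∑ i, fderiv ℝ (fun y => volumeDensity g x y * gradientComponent g f x i y) y₀
      (EuclideanSpace.single i (1 : ℝ))

/-- The eigenspace `𝓔_Λ` of smooth functions with `-Δ f = Λ f`. -/
def laplaceEigenspace (g : Bundle.RiemannianMetric (fun p : M => TangentSpace (𝓡 n) p)) (Λ : ℝ) :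
    Set C^∞⟮𝓡 n, M; 𝓘(ℝ, ℝ), ℝ⟯ :=
  {f | ∀ x, -laplaceBeltrami g f x = Λ * f x}

/-- `Λ` is an eigenvalue: some eigenfunction is not identically zero. -/
def IsLaplaceEigenvalue (g : Bundle.RiemannianMetric (fun p : M => TangentSpace (𝓡 n) p))
    (Λ : ℝ) : Prop :=
  ∃ f ∈ laplaceEigenspace g Λ, ∃ x, f x ≠ 0

/-- The nodal set `f⁻¹(0)` is regular: `0` is a regular value of `f`, i.e. the differential of `f`
is surjective (equivalently, nonzero) at every zero of `f`. -/
def HasRegularNodalSet (f : C^∞⟮𝓡 n, M; 𝓘(ℝ, ℝ), ℝ⟯) : Prop :=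
  ∀ x, f x = 0 → Function.Surjective (mvfderiv (𝓡 n) f x)

/-- The `C^r` topology on smooth functions: uniform convergence of all derivatives of order `≤ r`
on compact sets in charts. -/
@[reducible] def crTopology (n : ℕ) (M : Type*) [TopologicalSpace M]
    [ChartedSpace (EuclideanSpace ℝ (Fin n)) M] (r : ℕ) :
    TopologicalSpace C^∞⟮𝓡 n, M; 𝓘(ℝ, ℝ), ℝ⟯ :=
  ⨅ (x : M) (j : ℕ) (_ : j ≤ r), TopologicalSpace.induced
    (fun f => UniformOnFun.ofFun
      {K | IsCompact K ∧ K ⊆ (chartAt (EuclideanSpace ℝ (Fin n)) x).target}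
      (iteratedFDeriv ℝ j (f ∘ (chartAt (EuclideanSpace ℝ (Fin n)) x).symm)))
    inferInstance

/-- The `C^r` topology on the eigenspace `𝓔_Λ`. -/
@[reducible] def eigenspaceTopology (g : Bundle.RiemannianMetric (fun p : M => TangentSpace (𝓡 n) p)) (Λ : ℝ)
    (r : ℕ) : TopologicalSpace (laplaceEigenspace g Λ) :=
  (crTopology n M r).induced Subtype.val

end Riemannian

/-! ### Pulling back an inner product to the tangent spaces -/

/-- The Riemannian metric `g_p(v, w) = ⟪A_p v, A_p w⟫` given by injective linear maps `A_p` from the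
tangent spaces to a Euclidean space. -/
def inducedMetric {n : ℕ} {M : Type*} [TopologicalSpace M]
    [ChartedSpace (EuclideanSpace ℝ (Fin n)) M]
    {F : Type*} [NormedAddCommGroup F] [InnerProductSpace ℝ F]
    (A : ∀ p : M, TangentSpace (𝓡 n) p →L[ℝ] F) (hA : ∀ p, Function.Injective (A p)) :
    Bundle.RiemannianMetric (fun p : M => TangentSpace (𝓡 n) p) where
  inner p := (ContinuousLinearMap.precomp ℝ (A p)).comp ((innerSL ℝ (E := F)).comp (A p))
  symm p v w := real_inner_comm (A p w) (A p v)
  pos p v hv := by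
    have : A p v ≠ 0 := fun h => hv (hA p (by simpa using h))
    exact real_inner_self_pos.2 this
  continuousAt p :=
    ((A p).continuous.inner (A p).continuous : Continuous fun v => ⟪A p v, A p v⟫_ℝ).continuousAt
  isVonNBounded p := by
    let B : EuclideanSpace ℝ (Fin n) →L[ℝ] F := A p
    have hB : Function.Injective B := hA p
    change Bornology.IsVonNBounded ℝ {v : EuclideanSpace ℝ (Fin n) | ⟪B v, B v⟫_ℝ < 1}
    obtain ⟨K, hK, hBK⟩ := B.toLinearMap.exists_antilipschitzWith (LinearMap.ker_eq_bot.2 hB)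
    refine (NormedSpace.isVonNBounded_ball ℝ (EuclideanSpace ℝ (Fin n)) (K + 1)).subset ?_
    intro v hv
    have h1 : ‖B v‖ < 1 := by
      have : ‖B v‖ ^ 2 < 1 := by rw [← real_inner_self_eq_norm_sq]; exact hv
      nlinarith [norm_nonneg (B v)]
    have h2 : ‖v‖ ≤ K * ‖B v‖ := by
      simpa using hBK.le_mul_dist v 0
    have h3 : (K : ℝ) * ‖B v‖ ≤ K := mul_le_of_le_one_right K.2 h1.le
    simp only [Metric.mem_ball, dist_zero_right]
    linarith

/-! ### The round sphere -/

/-- The unit sphere `S^n` in `ℝ^{n+1}`. -/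
abbrev RoundSphere (n : ℕ) : Type := Metric.sphere (0 : EuclideanSpace ℝ (Fin (n + 1))) 1

/-- The round metric on `S^n`, induced by the inclusion `S^n ⊆ ℝ^{n+1}`. -/
def roundMetric (n : ℕ) :
    Bundle.RiemannianMetric (fun p : RoundSphere n => TangentSpace (𝓡 n) p) :=
  inducedMetric (fun p => mvfderiv (𝓡 n)
      ((↑) : RoundSphere n → EuclideanSpace ℝ (Fin (n + 1))) p)
    (fun p =>
      haveI := Fact.mk (@finrank_euclideanSpace_fin ℝ _ (n + 1))
      injective_mvfderiv_subtypeVal_sphere p)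

/-! ### The flat torus -/

/-- The lattice `(2πℤ)^n` in `ℝ^n`. -/
def torusLattice (n : ℕ) : AddSubgroup (EuclideanSpace ℝ (Fin n)) where
  carrier := {v | ∃ k : Fin n → ℤ, ∀ i, v i = 2 * Real.pi * k i}
  zero_mem' := ⟨0, by simp⟩
  add_mem' := by
    rintro v w ⟨k, hk⟩ ⟨l, hl⟩
    exact ⟨k + l, fun i => by simp [hk, hl, mul_add]⟩
  neg_mem' := by
    rintro v ⟨k, hk⟩
    exact ⟨-k, fun i => by simp [hk]⟩

/-- The torus `T^n = ℝ^n / (2πℤ)^n`. -/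
abbrev FlatTorus (n : ℕ) : Type := EuclideanSpace ℝ (Fin n) ⧸ torusLattice n

/-- The projection `ℝ^n → T^n`. -/
def torusProj (n : ℕ) (z : EuclideanSpace ℝ (Fin n)) : FlatTorus n := QuotientAddGroup.mk z

theorem torusLattice_isDiscrete (n : ℕ) :
    IsDiscrete (torusLattice n : Set (EuclideanSpace ℝ (Fin n))) := by
  rw [isDiscrete_iff_discreteTopology]
  refine discreteTopology_of_isOpen_singleton_zero ?_
  have h : ({0} : Set (torusLattice n)) = Subtype.val ⁻¹' Metric.ball 0 1 := by
    ext ⟨v, k, hk⟩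
    simp only [Set.mem_singleton_iff, Set.mem_preimage, Metric.mem_ball, dist_zero_right]
    constructor
    · intro hv
      have : v = 0 := congrArg Subtype.val hv
      simp [this]
    · intro hv
      refine Subtype.ext ?_
      ext i
      have h1 : |v i| < 1 := by
        simpa using (PiLp.norm_apply_le v i).trans_lt hv
      rw [hk i, abs_mul, abs_of_pos Real.two_pi_pos] at h1
      have h2 : |(k i : ℝ)| < 1 := by
        nlinarith [Real.two_le_pi, abs_nonneg (k i : ℝ)]
      have h3 : k i = 0 := by
        rw [← Int.abs_lt_one_iff]; exact_mod_cast h2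
      simp [hk i, h3]
  rw [h]
  exact Metric.isOpen_ball.preimage continuous_subtype_val

theorem torusProj_isLocalHomeomorph (n : ℕ) : IsLocalHomeomorph (torusProj n) :=
  ((torusLattice n).isAddQuotientCoveringMap (torusLattice_isDiscrete n)).isCoveringMap
    |>.isLocalHomeomorph

theorem torusProj_surjective (n : ℕ) : Function.Surjective (torusProj n) :=
  QuotientAddGroup.mk_surjective

/-- The manifold structure on `T^n`: the charts are local inverses of the projection. -/
instance torusChartedSpace (n : ℕ) : ChartedSpace (EuclideanSpace ℝ (Fin n)) (FlatTorus n) :=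
  (torusProj_isLocalHomeomorph n).chartedSpace (torusProj_surjective n)

/-- Local inverses of the projection agree with it up to translation by a lattice vector. -/
theorem torusProj_localInverse (n : ℕ) (q z : EuclideanSpace ℝ (Fin n))
    (hz : torusProj n z ∈ ((torusProj_isLocalHomeomorph n).localInverseAt q).source) :
    ∃ k : EuclideanSpace ℝ (Fin n), ∀ᶠ z' in 𝓝 z,
      (torusProj_isLocalHomeomorph n).localInverseAt q (torusProj n z') = z' + k := by
  set e := (torusProj_isLocalHomeomorph n).localInverseAt q with he
  have hs : ∀ w, e.symm w = torusProj n w :=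
    congrFun ((torusProj_isLocalHomeomorph n).localInverseAt_symm q)
  set k := e (torusProj n z) - z with hk
  have hkL : k ∈ torusLattice n := by
    have : torusProj n z = torusProj n (e (torusProj n z)) := by
      rw [← hs (e _), e.left_inv hz]
    rw [hk, sub_eq_neg_add]
    exact QuotientAddGroup.eq.1 this
  refine ⟨k, ?_⟩
  have hmem : z + k ∈ e.target := by
    rw [hk, add_sub_cancel]; exact e.map_source hz
  have hc : ContinuousAt (fun z' : EuclideanSpace ℝ (Fin n) => z' + k) z := by fun_prop
  filter_upwards [hc.preimage_mem_nhds (e.open_target.mem_nhds hmem)] with z' hz'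
  have h1 : torusProj n z' = e.symm (z' + k) := by
    rw [hs]
    exact QuotientAddGroup.eq.2 (by simpa using hkL)
  rw [h1, e.right_inv hz']

instance torusIsManifold (n : ℕ) : IsManifold (𝓡 n) ∞ (FlatTorus n) := by
  refine isManifold_of_contDiffOn (𝓡 n) ∞ (FlatTorus n) ?_
  rintro _ _ ⟨q, rfl⟩ ⟨q', rfl⟩
  intro z hz
  refine ContDiffAt.contDiffWithinAt ?_
  simp only [chartAt_self_eq, OpenPartialHomeomorph.trans_refl, OpenPartialHomeomorph.coe_trans,
    modelWithCornersSelf_coe, modelWithCornersSelf_coe_symm,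
    IsLocalHomeomorph.localInverseAt_symm, OpenPartialHomeomorph.trans_source,
    OpenPartialHomeomorph.symm_source, Set.preimage_id, Set.range_id, Set.inter_univ,
    Set.mem_inter_iff, Set.mem_preimage, Function.id_comp, Function.comp_id] at hz ⊢
  obtain ⟨k, hk⟩ := torusProj_localInverse n _ z hz.2
  exact (contDiffAt_id.add contDiffAt_const).congr_of_eventuallyEq hk

/-- The flat metric on `T^n`. Each tangent space is identified with `ℝ^n` by the chart at its base
point, a local inverse of the projection; this is the metric for which the projection `ℝ^n → T^n`
is a local isometry, see `flatMetric_torusProj`. -/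
def flatMetric (n : ℕ) :
    Bundle.RiemannianMetric (fun p : FlatTorus n => TangentSpace (𝓡 n) p) :=
  inducedMetric (F := EuclideanSpace ℝ (Fin n))
    (fun p => ContinuousLinearMap.id ℝ (TangentSpace (𝓡 n) p)) (fun _ => Function.injective_id)

theorem hasMFDerivAt_torusProj (n : ℕ) (z : EuclideanSpace ℝ (Fin n)) :
    HasMFDerivAt (𝓡 n) (𝓡 n) (torusProj n) z
      (ContinuousLinearMap.id ℝ (EuclideanSpace ℝ (Fin n))) := by
  refine ⟨(torusProj_isLocalHomeomorph n).continuous.continuousAt, ?_⟩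
  obtain ⟨k, hk⟩ := torusProj_localInverse n _ z
    (mem_chart_source (EuclideanSpace ℝ (Fin n)) (torusProj n z)).1
  refine HasFDerivAt.hasFDerivWithinAt ?_
  exact ((hasFDerivAt_id z).add_const k).congr_of_eventuallyEq hk

/-- The projection `ℝ^n → T^n` is a local isometry for the flat metric. -/
theorem flatMetric_torusProj (n : ℕ) (z : EuclideanSpace ℝ (Fin n))
    (v w : TangentSpace (𝓡 n) z) :
    (flatMetric n).inner (torusProj n z) (mfderiv (𝓡 n) (𝓡 n) (torusProj n) z v)
      (mfderiv (𝓡 n) (𝓡 n) (torusProj n) z w) =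
      inner ℝ (show EuclideanSpace ℝ (Fin n) from v) (show EuclideanSpace ℝ (Fin n) from w) := by
  rw [(hasMFDerivAt_torusProj n z).mfderiv]
  rfl

end

/-!
The proof is a transversality argument which uses, of the eigenspace `𝓔_Λ`, only that the `1`-jets
(value, differential) of its members fill the whole jet space `ℝ × (ℝ^n)*` at every point
(`RealisesJets`).

*From jets to genericity.* A function has a regular nodal set iff its `1`-jet, read in a chart, never
vanishes. The jet depends jointly continuously on the function, in the `C^r` topology with `r ≥ 1`,
and on the point, so on a compact set regularity is an open condition (`isOpen_regularOn`). Let now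
`w_0, …, w_n ∈ 𝓔_Λ` have jets at `p` which form a basis of the jet space. Near `p` the jets still
form a basis, so `f + ∑ c_i w_i` has a singular zero with coordinates `y` for exactly one `c = c(y)`,
which is a `C¹` function of `y`. A `C¹` map from `ℝ^n` to `ℝ^{n+1}` has an image with dense
complement, so arbitrarily small `c` remove all singular zeros near `p`
(`RealisesJets.exists_nhds_dense_regularOn`). Finitely many such neighbourhoods cover the manifold,
and finitely many open dense sets have a dense intersection.

*From symmetry to jets.* Both the sphere and the torus have isometries which move any point to any
other, and which induce, at each point, the reflections of the coordinates in the hyperplanes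
orthogonal to the `e_i` and the `e_i - e_j`. As `Λ ≠ 0`, a nonzero eigenfunction is not constant.
Hence at each point some eigenfunction does not vanish and some eigenfunction has a nonzero
differential. If `f'` is the mirror image of `f` under the reflection in `uᗮ`, then `f - f'` vanishes
at the point and its differential is a multiple of `⟪u, ·⟫`; in this way all covectors are obtained
(`realisesJets_of_reflections`).

*Invariance of the eigenspaces.* In the charts at hand, the Laplace–Beltrami operator at the centre
of the chart is the flat Laplacian (`IsFlatAtCenters`): for the torus the charts are isometries, and
for the sphere they are stereographic projections, which are conformal with a conformal factor that
is `1` and critical at the centre. The isometries used are affine isometries in these charts, and the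
flat Laplacian commutes with those.
-/

noncomputable section

open Set Filter Module
open scoped Laplacian

/-! ### Functions in coordinates -/

section Local

variable {n : ℕ} {M : Type*} [TopologicalSpace M] [ChartedSpace (EuclideanSpace ℝ (Fin n)) M]

/-- The expression of a smooth function in the chart `chartAt x`. It is a total function, smooth on
the target of the chart and uncontrolled elsewhere. -/
def localRep (f : C^∞⟮𝓡 n, M; 𝓘(ℝ, ℝ), ℝ⟯) (x : M) : EuclideanSpace ℝ (Fin n) → ℝ :=
  f ∘ (chartAt (EuclideanSpace ℝ (Fin n)) x).symm

/-- The `1`-jet (value, differential) of a smooth function in the chart `chartAt x`, at the point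
with coordinates `y`. -/
def jet (f : C^∞⟮𝓡 n, M; 𝓘(ℝ, ℝ), ℝ⟯) (x : M) (y : EuclideanSpace ℝ (Fin n)) :
    ℝ × (EuclideanSpace ℝ (Fin n) →L[ℝ] ℝ) :=
  (localRep f x y, fderiv ℝ (localRep f x) y)

theorem localRep_chartAt (f : C^∞⟮𝓡 n, M; 𝓘(ℝ, ℝ), ℝ⟯) {x p : M}
    (hp : p ∈ (chartAt (EuclideanSpace ℝ (Fin n)) x).source) :
    localRep f x (chartAt (EuclideanSpace ℝ (Fin n)) x p) = f p := by
  simp [localRep, hp]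

theorem localRep_add (f g : C^∞⟮𝓡 n, M; 𝓘(ℝ, ℝ), ℝ⟯) (x : M) :
    localRep (f + g) x = localRep f x + localRep g x := rfl

theorem localRep_smul (c : ℝ) (f : C^∞⟮𝓡 n, M; 𝓘(ℝ, ℝ), ℝ⟯) (x : M) :
    localRep (c • f) x = c • localRep f x := rfl

theorem localRep_sum {ι : Type*} (s : Finset ι) (f : ι → C^∞⟮𝓡 n, M; 𝓘(ℝ, ℝ), ℝ⟯) (x : M) :
    localRep (∑ i ∈ s, f i) x = ∑ i ∈ s, localRep (f i) x := by
  classical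
  induction s using Finset.induction_on with
  | empty => rfl
  | insert a s ha ih => rw [Finset.sum_insert ha, Finset.sum_insert ha, localRep_add, ih]

variable [IsManifold (𝓡 n) ∞ M]

theorem contDiffOn_localRep (f : C^∞⟮𝓡 n, M; 𝓘(ℝ, ℝ), ℝ⟯) (x : M) :
    ContDiffOn ℝ ∞ (localRep f x) (chartAt (EuclideanSpace ℝ (Fin n)) x).target := by
  rw [← contMDiffOn_iff_contDiffOn]
  exact f.contMDiff.comp_contMDiffOn (contMDiffOn_chart_symm (I := 𝓡 n))

theorem contDiffAt_localRep (f : C^∞⟮𝓡 n, M; 𝓘(ℝ, ℝ), ℝ⟯) {x : M} {y : EuclideanSpace ℝ (Fin n)}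
    (hy : y ∈ (chartAt (EuclideanSpace ℝ (Fin n)) x).target) :
    ContDiffAt ℝ ∞ (localRep f x) y :=
  (contDiffOn_localRep f x).contDiffAt
    ((chartAt (EuclideanSpace ℝ (Fin n)) x).open_target.mem_nhds hy)

theorem contDiffAt_jet (f : C^∞⟮𝓡 n, M; 𝓘(ℝ, ℝ), ℝ⟯) {x : M} {y : EuclideanSpace ℝ (Fin n)}
    (hy : y ∈ (chartAt (EuclideanSpace ℝ (Fin n)) x).target) :
    ContDiffAt ℝ 1 (jet f x) y :=
  ((contDiffAt_localRep f hy).of_le (by exact_mod_cast le_top)).prodMk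
    (((contDiffAt_localRep f hy).fderiv_right (m := ∞) (by simp)).of_le (by exact_mod_cast le_top))

theorem jet_add (f g : C^∞⟮𝓡 n, M; 𝓘(ℝ, ℝ), ℝ⟯) {x : M} {y : EuclideanSpace ℝ (Fin n)}
    (hy : y ∈ (chartAt (EuclideanSpace ℝ (Fin n)) x).target) :
    jet (f + g) x y = jet f x y + jet g x y := by
  refine Prod.ext rfl ?_
  simp only [jet, localRep_add]
  exact fderiv_add ((contDiffAt_localRep f hy).differentiableAt (by simp))
    ((contDiffAt_localRep g hy).differentiableAt (by simp))

theorem jet_smul (c : ℝ) (f : C^∞⟮𝓡 n, M; 𝓘(ℝ, ℝ), ℝ⟯) {x : M} {y : EuclideanSpace ℝ (Fin n)}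
    (hy : y ∈ (chartAt (EuclideanSpace ℝ (Fin n)) x).target) :
    jet (c • f) x y = c • jet f x y := by
  refine Prod.ext rfl ?_
  simp only [jet, localRep_smul]
  exact fderiv_const_smul ((contDiffAt_localRep f hy).differentiableAt (by simp)) c

/-- Taking the `1`-jet at a point, as a linear map. -/
def jetLinearMap (x : M) {y : EuclideanSpace ℝ (Fin n)}
    (hy : y ∈ (chartAt (EuclideanSpace ℝ (Fin n)) x).target) :
    C^∞⟮𝓡 n, M; 𝓘(ℝ, ℝ), ℝ⟯ →ₗ[ℝ] ℝ × (EuclideanSpace ℝ (Fin n) →L[ℝ] ℝ) where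
  toFun f := jet f x y
  map_add' f g := jet_add f g hy
  map_smul' c f := jet_smul c f hy

/-- Surjectivity of the differential can be tested in any chart. -/
theorem surjective_mvfderiv_iff (f : C^∞⟮𝓡 n, M; 𝓘(ℝ, ℝ), ℝ⟯) {x p : M}
    (hp : p ∈ (chartAt (EuclideanSpace ℝ (Fin n)) x).source) :
    Function.Surjective (mvfderiv (𝓡 n) f p) ↔
      fderiv ℝ (localRep f x) (chartAt (EuclideanSpace ℝ (Fin n)) x p) ≠ 0 := by
  have : IsManifold (𝓡 n) 1 M := IsManifold.of_le (n := ∞) (by exact_mod_cast le_top)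
  set φ := chartAt (EuclideanSpace ℝ (Fin n)) x with hφ
  have hy : φ p ∈ φ.target := φ.map_source hp
  have hs : φ.symm (φ p) = p := φ.left_inv hp
  have hM : φ.MDifferentiable (𝓡 n) (𝓡 n) := mdifferentiable_chart x
  have hbij : Function.Bijective (mfderiv (𝓡 n) (𝓡 n) φ.symm (φ p)) :=
    hM.symm.mfderiv_bijective hy
  have hf : MDifferentiableAt (𝓡 n) 𝓘(ℝ, ℝ) f (φ.symm (φ p)) :=
    (f.contMDiff _).mdifferentiableAt (by simp)
  have hcomp : fderiv ℝ (localRep f x) (φ p) =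
      (mvfderiv (𝓡 n) f (φ.symm (φ p))).comp (mfderiv (𝓡 n) (𝓡 n) φ.symm (φ p)) := by
    rw [← mfderiv_eq_fderiv]
    exact mfderiv_comp (I' := 𝓡 n) (φ p) hf (hM.symm.mdifferentiableAt hy)
  have h1 : Function.Surjective (mvfderiv (𝓡 n) f p) ↔
      Function.Surjective (mvfderiv (𝓡 n) f (φ.symm (φ p))) := by rw [hs]
  have h2 : Function.Surjective (fderiv ℝ (localRep f x) (φ p)) ↔
      Function.Surjective (mvfderiv (𝓡 n) f (φ.symm (φ p))) := by
    rw [hcomp]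
    exact hbij.surjective.of_comp_iff _
  rw [h1, ← h2]
  exact ⟨fun h h0 => by simpa [h0] using h 1, fun h =>
    LinearMap.surjective (f := (fderiv ℝ (localRep f x) (φ p)).toLinearMap)
      (fun h0 => h (ContinuousLinearMap.coe_injective h0))⟩

/-- Regularity of the nodal set can be tested in any chart. -/
theorem regular_iff_jet_ne_zero (f : C^∞⟮𝓡 n, M; 𝓘(ℝ, ℝ), ℝ⟯) {x p : M}
    (hp : p ∈ (chartAt (EuclideanSpace ℝ (Fin n)) x).source) :
    (f p = 0 → Function.Surjective (mvfderiv (𝓡 n) f p)) ↔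
      jet f x (chartAt (EuclideanSpace ℝ (Fin n)) x p) ≠ 0 := by
  rw [surjective_mvfderiv_iff f hp, jet, localRep_chartAt f hp, Ne, Ne, Prod.mk_eq_zero]
  tauto

end Local

/-! ### The `C^r` topology -/

section Topology

variable {n : ℕ} {M : Type*} [TopologicalSpace M] [ChartedSpace (EuclideanSpace ℝ (Fin n)) M]

theorem continuous_iteratedFDeriv_localRep (r : ℕ) (x : M) {j : ℕ} (hj : j ≤ r) :
    @Continuous _ _ (crTopology n M r) _ (fun f : C^∞⟮𝓡 n, M; 𝓘(ℝ, ℝ), ℝ⟯ =>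
      UniformOnFun.ofFun
        {K | IsCompact K ∧ K ⊆ (chartAt (EuclideanSpace ℝ (Fin n)) x).target}
        (iteratedFDeriv ℝ j (localRep f x))) := by
  rw [continuous_iff_le_induced]
  exact (iInf_le _ x).trans ((iInf_le _ j).trans (iInf_le _ hj))

variable [IsManifold (𝓡 n) ∞ M]

/-- The derivatives of order `≤ r` depend jointly continuously on the function, in the `C^r`
topology, and the point. -/
theorem continuousAt_iteratedFDeriv_localRep (r : ℕ) (x : M) {j : ℕ} (hj : j ≤ r)
    (f : C^∞⟮𝓡 n, M; 𝓘(ℝ, ℝ), ℝ⟯) {y : EuclideanSpace ℝ (Fin n)}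
    (hy : y ∈ (chartAt (EuclideanSpace ℝ (Fin n)) x).target) :
    letI := crTopology n M r
    ContinuousAt (fun q : C^∞⟮𝓡 n, M; 𝓘(ℝ, ℝ), ℝ⟯ × EuclideanSpace ℝ (Fin n) =>
      iteratedFDeriv ℝ j (localRep q.1 x) q.2) (f, y) := by
  let _ := crTopology n M r
  have hc := continuous_iteratedFDeriv_localRep (n := n) r x hj
  obtain ⟨K, hK, hyK, hKt⟩ := exists_compact_subset
    (chartAt (EuclideanSpace ℝ (Fin n)) x).open_target hy
  have hcy : ContinuousAt (iteratedFDeriv ℝ j (localRep f x)) y :=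
    (contDiffAt_localRep f hy).continuousAt_iteratedFDeriv (by exact_mod_cast le_top)
  have h2 := UniformOnFun.continuousAt_eval₂
    (𝔖 := {K | IsCompact K ∧ K ⊆ (chartAt (EuclideanSpace ℝ (Fin n)) x).target})
    (f := UniformOnFun.ofFun _ (iteratedFDeriv ℝ j (localRep f x))) (x := y)
    ⟨K, ⟨hK, hKt⟩, mem_interior_iff_mem_nhds.1 hyK⟩ hcy
  exact h2.comp (f := fun q : C^∞⟮𝓡 n, M; 𝓘(ℝ, ℝ), ℝ⟯ × EuclideanSpace ℝ (Fin n) =>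
    (UniformOnFun.ofFun _ (iteratedFDeriv ℝ j (localRep q.1 x)), q.2)) (x := (f, y))
    ((hc.comp continuous_fst).prodMk continuous_snd).continuousAt

theorem continuousAt_jet {r : ℕ} (hr : 1 ≤ r) (x : M)
    (f : C^∞⟮𝓡 n, M; 𝓘(ℝ, ℝ), ℝ⟯) {y : EuclideanSpace ℝ (Fin n)}
    (hy : y ∈ (chartAt (EuclideanSpace ℝ (Fin n)) x).target) :
    letI := crTopology n M r
    ContinuousAt (fun q : C^∞⟮𝓡 n, M; 𝓘(ℝ, ℝ), ℝ⟯ × EuclideanSpace ℝ (Fin n) =>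
      jet q.1 x q.2) (f, y) := by
  let _ := crTopology n M r
  have h0 := continuousAt_iteratedFDeriv_localRep r x (Nat.zero_le r) f hy
  have h1 := continuousAt_iteratedFDeriv_localRep r x hr f hy
  refine ContinuousAt.prodMk ?_ ?_
  · exact ((continuousMultilinearCurryFin0 ℝ (EuclideanSpace ℝ (Fin n)) ℝ).continuous.continuousAt
      ).comp h0
  · refine ((continuousMultilinearCurryFin1 ℝ (EuclideanSpace ℝ (Fin n)) ℝ
      ).continuous.continuousAt.comp h1).congr (Eventually.of_forall fun q => ?_)
    ext v
    simp [iteratedFDeriv_one_apply]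

/-- Regularity of the zeros in a compact set is an open condition. -/
theorem isOpen_regularOn {r : ℕ} (hr : 1 ≤ r) {K : Set M} (hK : IsCompact K) :
    IsOpen[crTopology n M r] {f : C^∞⟮𝓡 n, M; 𝓘(ℝ, ℝ), ℝ⟯ |
      ∀ p ∈ K, f p = 0 → Function.Surjective (mvfderiv (𝓡 n) f p)} := by
  let _ := crTopology n M r
  rw [isOpen_iff_eventually]
  intro f hf
  refine hK.eventually_forall_of_forall_eventually fun p hp => ?_
  set φ := chartAt (EuclideanSpace ℝ (Fin n)) p with hφ
  have hps : p ∈ φ.source := mem_chart_source _ p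
  have h1 : ContinuousAt (fun q : C^∞⟮𝓡 n, M; 𝓘(ℝ, ℝ), ℝ⟯ × M => jet q.1 p (φ q.2)) (f, p) :=
    (continuousAt_jet hr p f (φ.map_source hps)).comp
      (f := fun q : C^∞⟮𝓡 n, M; 𝓘(ℝ, ℝ), ℝ⟯ × M => (q.1, φ q.2)) (x := (f, p))
      (continuousAt_fst.prodMk (ContinuousAt.comp (x := (f, p)) (φ.continuousAt hps)
        continuousAt_snd))
  have h2 := h1.eventually_ne ((regular_iff_jet_ne_zero f hps).1 (hf p hp))
  have h3 : ∀ᶠ q : C^∞⟮𝓡 n, M; 𝓘(ℝ, ℝ), ℝ⟯ × M in 𝓝 (f, p), q.2 ∈ φ.source :=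
    continuousAt_snd.eventually (φ.open_source.mem_nhds hps)
  filter_upwards [h2, h3] with q hq hqs
  exact (regular_iff_jet_ne_zero q.1 hqs).2 hq

/-- Finite-dimensional affine families of functions are continuous for the `C^r` topology. -/
theorem continuous_add_sum_smul (r : ℕ) {ι : Type*} [Fintype ι]
    (f : C^∞⟮𝓡 n, M; 𝓘(ℝ, ℝ), ℝ⟯) (w : ι → C^∞⟮𝓡 n, M; 𝓘(ℝ, ℝ), ℝ⟯) :
    @Continuous _ _ _ (crTopology n M r) (fun c : ι → ℝ => f + ∑ i, c i • w i) := by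
  refine continuous_iInf_rng.2 fun x => continuous_iInf_rng.2 fun j => continuous_iInf_rng.2
    fun hj => continuous_induced_rng.2 ?_
  rw [UniformOnFun.continuous_rng_iff]
  rintro K ⟨hK, hKt⟩
  have hDc : ∀ g : C^∞⟮𝓡 n, M; 𝓘(ℝ, ℝ), ℝ⟯,
      Continuous fun y : K => iteratedFDeriv ℝ j (localRep g x) y := fun g =>
    continuous_iff_continuousAt.2 fun y => ContinuousAt.comp (x := y)
      ((contDiffAt_localRep g (hKt y.2)).continuousAt_iteratedFDeriv (by exact_mod_cast le_top))
      continuousAt_subtype_val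
  have heq : ∀ (c : ι → ℝ) (y : K), iteratedFDeriv ℝ j (localRep (f + ∑ i, c i • w i) x) y =
      iteratedFDeriv ℝ j (localRep f x) y + ∑ i, c i • iteratedFDeriv ℝ j (localRep (w i) x) y := by
    intro c y
    have hd : ∀ g : C^∞⟮𝓡 n, M; 𝓘(ℝ, ℝ), ℝ⟯, ContDiffAt ℝ j (localRep g x) y := fun g =>
      (contDiffAt_localRep g (hKt y.2)).of_le (by exact_mod_cast le_top)
    rw [localRep_add, iteratedFDeriv_add_apply (hd _) (hd _), localRep_sum]
    rw [iteratedFDeriv_sum_apply fun i _ => by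
      rw [localRep_smul]; exact contDiffAt_const.smul (hd (w i))]
    simp only [localRep_smul, iteratedFDeriv_const_smul_apply (hd _)]
  refine continuous_iff_continuousAt.2 fun c => ?_
  rw [ContinuousAt, UniformFun.tendsto_iff_tendstoUniformly]
  have : CompactSpace K := isCompact_iff_compactSpace.1 hK
  refine Continuous.tendstoUniformly (fun (c : ι → ℝ) (y : K) =>
    iteratedFDeriv ℝ j (localRep (f + ∑ i, c i • w i) x) y) ?_ c
  simp only [Function.HasUncurry.uncurry, heq]
  exact ((hDc f).comp continuous_snd).add (continuous_finsetSum _ fun i _ =>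
    ((continuous_apply i).comp continuous_fst).smul ((hDc (w i)).comp continuous_snd))

end Topology

/-! ### Spaces of functions that realise all `1`-jets -/

/-- If a `C¹` family of linear maps `J y : V → W` is invertible at `y₀` and `dim E < dim V`, then
for a dense set of `c : V` the equation `J y c = b y` has no solution `y` near `y₀`: the bad `c`
are the values of the `C¹` map `y ↦ (J y)⁻¹ (b y)`, which raises the dimension. -/
theorem exists_nhds_dense_forall_apply_ne {E V W : Type*}
    [NormedAddCommGroup E] [NormedSpace ℝ E] [FiniteDimensional ℝ E]
    [NormedAddCommGroup V] [NormedSpace ℝ V] [FiniteDimensional ℝ V]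
    [NormedAddCommGroup W] [NormedSpace ℝ W]
    (hdim : finrank ℝ E < finrank ℝ V) {J : E → V →L[ℝ] W} {y₀ : E} (hJ : ContDiffAt ℝ 1 J y₀)
    (e : V ≃L[ℝ] W) (he : J y₀ = e) {U : Set E} (hU : U ∈ 𝓝 y₀) :
    ∃ N ∈ 𝓝 y₀, N ⊆ U ∧ ∀ b : E → W, ContDiffOn ℝ 1 b N → Dense {c : V | ∀ y ∈ N, J y c ≠ b y} := by
  have hinv : ContDiffAt ℝ 1 (fun y => ContinuousLinearMap.inverse (J y)) y₀ :=
    ContDiffAt.comp (g := ContinuousLinearMap.inverse) y₀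
      (by rw [he]; exact contDiffAt_map_inverse e) hJ
  have hI : ∀ᶠ y in 𝓝 y₀, J y ∈ range ((↑) : (V ≃L[ℝ] W) → V →L[ℝ] W) :=
    hJ.continuousAt (by rw [he]; exact ContinuousLinearEquiv.nhds e)
  obtain ⟨u, hu, hgu⟩ := hinv.contDiffOn le_rfl (by simp)
  obtain ⟨ε, hε, hball⟩ := Metric.mem_nhds_iff.1 (inter_mem (inter_mem hu hI) hU)
  refine ⟨Metric.ball y₀ ε, Metric.ball_mem_nhds y₀ hε, fun y hy => (hball hy).2, fun b hb => ?_⟩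
  have hg : ContDiffOn ℝ 1 (fun y => ContinuousLinearMap.inverse (J y) (b y))
      (Metric.ball y₀ ε) := (hgu.mono fun y hy => (hball hy).1.1).clm_apply hb
  refine (hg.dense_compl_image_of_dimH_lt_finrank (convex_ball y₀ ε) subset_rfl ?_).mono ?_
  · refine (dimH_mono (subset_univ _)).trans_lt ?_
    rw [Real.dimH_univ_eq_finrank]
    exact_mod_cast hdim
  · intro c hc y hy hyc
    obtain ⟨e', he'⟩ := (hball hy).1.2
    refine hc ⟨y, hy, ?_⟩
    simp only [← hyc, ← he', ContinuousLinearMap.inverse_equiv]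
    simp

section Dense

variable {n : ℕ} {M : Type*} [TopologicalSpace M] [ChartedSpace (EuclideanSpace ℝ (Fin n)) M]
  [IsManifold (𝓡 n) ∞ M]

/-- The space `E` of functions realises all `1`-jets at `p`, expressed in the chart `chartAt p`. -/
def RealisesJets (E : Submodule ℝ C^∞⟮𝓡 n, M; 𝓘(ℝ, ℝ), ℝ⟯) (p : M) : Prop :=
  ∀ q : ℝ × (EuclideanSpace ℝ (Fin n) →L[ℝ] ℝ),
    ∃ f ∈ E, jet f p (chartAt (EuclideanSpace ℝ (Fin n)) p p) = q

/-- Near a point at which `E` realises all `1`-jets, a small perturbation within `E` removes the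
singular zeros. -/
theorem RealisesJets.exists_nhds_dense_regularOn {E : Submodule ℝ C^∞⟮𝓡 n, M; 𝓘(ℝ, ℝ), ℝ⟯} {p : M}
    (hE : RealisesJets E p) (r : ℕ) :
    ∃ N ∈ 𝓝 p, letI := crTopology n M r
      Dense {f : E | ∀ p ∈ N, f.1 p = 0 → Function.Surjective (mvfderiv (𝓡 n) f.1 p)} := by
  set φ := chartAt (EuclideanSpace ℝ (Fin n)) p with hφ
  have hps : p ∈ φ.source := mem_chart_source _ p
  have hpt : φ p ∈ φ.target := φ.map_source hps
  let b := Module.finBasis ℝ (ℝ × (EuclideanSpace ℝ (Fin n) →L[ℝ] ℝ))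
  choose w hwE hw using fun i => hE (b i)
  let J : EuclideanSpace ℝ (Fin n) → (Fin _ → ℝ) →L[ℝ] ℝ × (EuclideanSpace ℝ (Fin n) →L[ℝ] ℝ) :=
    fun y => ∑ i, (ContinuousLinearMap.proj i).smulRight (jet (w i) p y)
  have hJ : ContDiffAt ℝ 1 J (φ p) := ContDiffAt.sum fun i _ =>
    contDiffAt_const.smulRight (contDiffAt_jet (w i) hpt)
  have hdim : finrank ℝ (EuclideanSpace ℝ (Fin n)) <
      finrank ℝ (Fin (finrank ℝ (ℝ × (EuclideanSpace ℝ (Fin n) →L[ℝ] ℝ))) → ℝ) := by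
    rw [finrank_fin_fun, finrank_prod, finrank_self,
      ← (LinearMap.toContinuousLinearMap (𝕜 := ℝ) (E := EuclideanSpace ℝ (Fin n))
        (F' := ℝ)).finrank_eq, finrank_linearMap_self]
    omega
  obtain ⟨N, hN, hNt, hdense⟩ := exists_nhds_dense_forall_apply_ne hdim hJ
    b.equivFun.symm.toContinuousLinearEquiv (by
      ext1 c
      simp [J, hw, Basis.equivFun_symm_apply, hφ]) (φ.open_target.mem_nhds hpt)
  -- `f + ∑ c_i w_i` has a singular zero with coordinates `y` iff `J y c = -jet f y`
  refine ⟨φ.source ∩ φ ⁻¹' N, inter_mem (φ.open_source.mem_nhds hps)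
    (φ.continuousAt hps hN), ?_⟩
  let _ := crTopology n M r
  intro f
  have hmem : ∀ c : Fin _ → ℝ, f.1 + ∑ i, c i • w i ∈ E := fun c =>
    E.add_mem f.2 (E.sum_mem fun i _ => E.smul_mem _ (hwE i))
  have hcont : Continuous fun c : Fin _ → ℝ => (⟨f.1 + ∑ i, c i • w i, hmem c⟩ : E) :=
    (continuous_add_sum_smul r f.1 w).subtype_mk hmem
  have h0 := hdense (fun y => -jet f.1 p y)
    (fun y hy => (contDiffAt_jet f.1 (hNt hy)).neg.contDiffWithinAt) 0
  have hf : (⟨f.1 + ∑ i, (0 : Fin _ → ℝ) i • w i, hmem 0⟩ : E) = f := by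
    ext1; simp
  rw [← hf]
  refine map_mem_closure hcont h0 fun c hc q hq => ?_
  rw [regular_iff_jet_ne_zero _ hq.1]
  intro hjet
  refine hc (φ q) hq.2 ?_
  have hlin : jet (f.1 + ∑ i, c i • w i) p (φ q) = jet f.1 p (φ q) + J (φ q) c := by
    have := map_add (jetLinearMap p (hNt hq.2)) f.1 (∑ i, c i • w i)
    simp only [map_sum, map_smul] at this
    simpa [J, jetLinearMap] using this
  rw [hlin] at hjet
  exact eq_neg_of_add_eq_zero_right hjet

/-- On a compact manifold, a linear space of functions which realises all `1`-jets contains an open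
dense set of functions with regular nodal set. -/
theorem isOpen_and_dense_hasRegularNodalSet [CompactSpace M]
    {E : Submodule ℝ C^∞⟮𝓡 n, M; 𝓘(ℝ, ℝ), ℝ⟯} (hE : ∀ p, RealisesJets E p) {r : ℕ} (hr : 1 ≤ r) :
    letI := crTopology n M r
    IsOpen {f : E | HasRegularNodalSet f.1} ∧ Dense {f : E | HasRegularNodalSet f.1} := by
  let _ := crTopology n M r
  have hopen : ∀ K : Set M, IsCompact K →
      IsOpen {f : E | ∀ p ∈ K, f.1 p = 0 → Function.Surjective (mvfderiv (𝓡 n) f.1 p)} :=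
    fun K hK => (isOpen_regularOn hr hK).preimage continuous_subtype_val
  refine ⟨by simpa [HasRegularNodalSet] using hopen univ isCompact_univ, ?_⟩
  have hloc : ∀ p : M, ∃ K ∈ 𝓝 p, IsCompact K ∧
      Dense {f : E | ∀ p ∈ K, f.1 p = 0 → Function.Surjective (mvfderiv (𝓡 n) f.1 p)} := by
    intro p
    have : LocallyCompactSpace M := ChartedSpace.locallyCompactSpace (EuclideanSpace ℝ (Fin n)) M
    obtain ⟨N, hN, hd⟩ := (hE p).exists_nhds_dense_regularOn r
    obtain ⟨K, hK, hKN, hKc⟩ := local_compact_nhds hN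
    exact ⟨K, hK, hKc, hd.mono (by intro f hf q hq; exact hf q (hKN hq))⟩
  choose K hKn hKc hKd using hloc
  obtain ⟨t, -, ht⟩ := isCompact_univ.elim_nhds_subcover K fun p _ => hKn p
  refine ((t.finite_toSet.image fun p => {f : E | ∀ q ∈ K p, f.1 q = 0 →
    Function.Surjective (mvfderiv (𝓡 n) f.1 q)}).dense_sInter
    (forall_mem_image.2 fun p _ => hopen _ (hKc p))
    (forall_mem_image.2 fun p _ => hKd p)).mono ?_
  intro f hf q hq
  obtain ⟨p, hp, hqp⟩ := mem_iUnion₂.1 (ht (mem_univ q))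
  exact hf _ (mem_image_of_mem _ hp) q hqp hq

end Dense

/-! ### Jets from reflections -/

/-- The vectors `e_i` and `e_i - e_j`, whose hyperplane reflections generate the signed
permutations of the coordinates. -/
def coordinateRoots (n : ℕ) : Set (EuclideanSpace ℝ (Fin n)) :=
  {u | (∃ i, u = EuclideanSpace.single i 1) ∨
    ∃ i j, i ≠ j ∧ u = EuclideanSpace.single i 1 - EuclideanSpace.single j 1}

section Symmetry

variable {n : ℕ} {M : Type*} [TopologicalSpace M] [ChartedSpace (EuclideanSpace ℝ (Fin n)) M]
  [IsManifold (𝓡 n) ∞ M]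

/-- If `f'` has the jet of `f` reflected in the hyperplane `uᗮ`, then `f - f'` has value zero and
its differential is a multiple of `⟪u, ·⟫`, which is nonzero if `df(u) ≠ 0`. -/
theorem exists_jet_eq_inner {E : Submodule ℝ C^∞⟮𝓡 n, M; 𝓘(ℝ, ℝ), ℝ⟯} {p : M}
    {y : EuclideanSpace ℝ (Fin n)} (hy : y ∈ (chartAt (EuclideanSpace ℝ (Fin n)) p).target)
    {u : EuclideanSpace ℝ (Fin n)} {f f' : C^∞⟮𝓡 n, M; 𝓘(ℝ, ℝ), ℝ⟯} (hf : f ∈ E) (hf' : f' ∈ E)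
    (hjet : jet f' p y = ((jet f p y).1,
      (jet f p y).2.comp ((ℝ ∙ u)ᗮ.reflection : _ →L[ℝ] EuclideanSpace ℝ (Fin n))))
    (hu : (jet f p y).2 u ≠ 0) : (0, innerSL ℝ u) ∈ E.map (jetLinearMap p hy) := by
  have hu0 : u ≠ 0 := fun h => hu (by simp [h])
  have hn : ‖u‖ ^ 2 ≠ 0 := by positivity
  refine ⟨(‖u‖ ^ 2 / (2 * (jet f p y).2 u)) • (f - f'), E.smul_mem _ (E.sub_mem hf hf'), ?_⟩
  rw [map_smul, map_sub]
  change _ • (jet f p y - jet f' p y) = _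
  rw [hjet]
  refine Prod.ext (by simp) ?_
  ext v
  simp only [Prod.smul_snd, Prod.snd_sub, smul_apply, sub_apply,
    ContinuousLinearMap.comp_apply]
  change _ • ((jet f p y).2 v - (jet f p y).2 ((ℝ ∙ u)ᗮ.reflection v)) = ⟪u, v⟫_ℝ
  rw [Submodule.reflection_orthogonal_apply, Submodule.reflection_singleton_apply]
  simp only [map_neg, map_sub, smul_eq_mul]
  simp
  field_simp

/-- A space of functions which does not vanish at `p`, has a nonzero differential at `p`, and is
stable under the reflections of the tangent space at `p` in the `coordinateRoots`, realises all
`1`-jets at `p`. -/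
theorem realisesJets_of_reflections {E : Submodule ℝ C^∞⟮𝓡 n, M; 𝓘(ℝ, ℝ), ℝ⟯} {p : M}
    (hval : ∃ f ∈ E, f p ≠ 0)
    (hder : ∃ f ∈ E, fderiv ℝ (localRep f p) (chartAt (EuclideanSpace ℝ (Fin n)) p p) ≠ 0)
    (hrefl : ∀ u ∈ coordinateRoots n, ∀ f ∈ E, ∃ f' ∈ E,
      jet f' p (chartAt (EuclideanSpace ℝ (Fin n)) p p) =
        ((jet f p (chartAt (EuclideanSpace ℝ (Fin n)) p p)).1,
          (jet f p (chartAt (EuclideanSpace ℝ (Fin n)) p p)).2.comp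
            ((ℝ ∙ u)ᗮ.reflection : _ →L[ℝ] EuclideanSpace ℝ (Fin n)))) :
    RealisesJets E p := by
  set φ := chartAt (EuclideanSpace ℝ (Fin n)) p with hφ
  have hps : p ∈ φ.source := mem_chart_source _ p
  have hpt : φ p ∈ φ.target := φ.map_source hps
  let R := E.map (jetLinearMap p hpt)
  have hroot : ∀ u ∈ coordinateRoots n, ∀ f ∈ E, (jet f p (φ p)).2 u ≠ 0 →
      (0, innerSL ℝ u) ∈ R := by
    intro u hu f hf hfu
    obtain ⟨f', hf', hjet⟩ := hrefl u hu f hf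
    exact exists_jet_eq_inner hpt hf hf' hjet hfu
  -- the differential of some function is nonzero on a basis vector, which then spreads to the others
  have hsingle : ∀ j, (0, innerSL ℝ (EuclideanSpace.single j (1 : ℝ))) ∈ R := by
    obtain ⟨f, hf, hfd⟩ := hder
    obtain ⟨i, hi⟩ : ∃ i, (jet f p (φ p)).2 (EuclideanSpace.single i 1) ≠ 0 := by
      by_contra! h
      refine hfd (ContinuousLinearMap.coe_injective
        ((EuclideanSpace.basisFun (Fin n) ℝ).toBasis.ext fun i => ?_))
      simpa [jet] using h i
    have hi' := hroot _ (Or.inl ⟨i, rfl⟩) f hf hi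
    intro j
    rcases eq_or_ne i j with rfl | hij
    · exact hi'
    obtain ⟨g, hg, hgi⟩ := hi'
    have hgi2 : jet g p (φ p) = (0, innerSL ℝ (EuclideanSpace.single i (1 : ℝ))) := hgi
    have hij' := hroot (EuclideanSpace.single i 1 - EuclideanSpace.single j 1)
      (Or.inr ⟨i, j, hij, rfl⟩) g hg (by simp [hgi2, hij.symm, inner_sub_right, EuclideanSpace.inner_single_left])
    have := R.sub_mem ⟨g, hg, hgi⟩ hij'
    simpa [hgi] using this
  have hcov : ∀ ℓ : EuclideanSpace ℝ (Fin n) →L[ℝ] ℝ, (0, ℓ) ∈ R := by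
    intro ℓ
    have hℓ : ((0 : ℝ), ℓ) = ∑ j, ℓ (EuclideanSpace.single j (1 : ℝ)) •
        ((0 : ℝ), innerSL ℝ (EuclideanSpace.single j (1 : ℝ))) := by
      refine Prod.ext (by simp [Prod.fst_sum]) (ContinuousLinearMap.coe_injective
        ((EuclideanSpace.basisFun (Fin n) ℝ).toBasis.ext fun i => ?_))
      simp [Prod.snd_sum, EuclideanSpace.inner_single_left]
    rw [hℓ]
    exact R.sum_mem fun j _ => R.smul_mem _ (hsingle j)
  rintro ⟨a, ℓ⟩
  obtain ⟨w, hw, hwp⟩ := hval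
  have hw1 : (jet w p (φ p)).1 = w p := localRep_chartAt w hps
  have hsum := R.add_mem (R.smul_mem (a / w p) ⟨w, hw, rfl⟩)
    (hcov (ℓ - (a / w p) • (jet w p (φ p)).2))
  obtain ⟨f, hf, hfj⟩ := hsum
  refine ⟨f, hf, hfj.trans ?_⟩
  change (a / w p) • jet w p (φ p) + _ = _
  refine Prod.ext ?_ (by simp)
  simp [hw1, hwp]

end Symmetry

/-! ### Isometric changes of coordinates and eigenspaces -/

/-- The Laplacian of a Euclidean space commutes with affine isometries. -/
theorem laplacian_comp_isometry {E : Type*} [NormedAddCommGroup E] [InnerProductSpace ℝ E]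
    [FiniteDimensional ℝ E] (g : E → ℝ) (L : E ≃ₗᵢ[ℝ] E) (a b : E) :
    Δ (fun z => g (b + L (z - a))) a = Δ g b := by
  have h : ∀ v : E, iteratedFDeriv ℝ 2 (fun z => g (b + L (z - a))) a ![v, v] =
      iteratedFDeriv ℝ 2 g b ![L v, L v] := by
    intro v
    have h1 := L.toContinuousLinearEquiv.iteratedFDerivWithin_comp_right
      (fun z => g (b + z)) uniqueDiffOn_univ (mem_univ (L.toContinuousLinearEquiv 0)) 2
    rw [preimage_univ, iteratedFDerivWithin_univ, iteratedFDerivWithin_univ] at h1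
    rw [iteratedFDeriv_comp_sub 2 a a (f := fun z => g (b + L z)), sub_self]
    erw [h1]
    rw [iteratedFDeriv_comp_add_left]
    simp only [ContinuousMultilinearMap.compContinuousLinearMap_apply, map_zero, add_zero]
    congr 1
    ext i
    fin_cases i <;> rfl
  rw [InnerProductSpace.laplacian_eq_iteratedFDeriv_orthonormalBasis _ (stdOrthonormalBasis ℝ E),
    InnerProductSpace.laplacian_eq_iteratedFDeriv_orthonormalBasis g
      ((stdOrthonormalBasis ℝ E).map L)]
  simp only [h, OrthonormalBasis.map_apply]

theorem sum_fderiv_fderiv_eq_laplacian {n : ℕ} {F : EuclideanSpace ℝ (Fin n) → ℝ}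
    {y : EuclideanSpace ℝ (Fin n)} (hF : ContDiffAt ℝ 2 F y) :
    ∑ i, fderiv ℝ (fun z => fderiv ℝ F z (EuclideanSpace.single i 1)) y
      (EuclideanSpace.single i 1) = Δ F y := by
  rw [InnerProductSpace.laplacian_eq_iteratedFDeriv_orthonormalBasis F
    (EuclideanSpace.basisFun (Fin n) ℝ)]
  have hd : DifferentiableAt ℝ (fderiv ℝ F) y :=
    (hF.fderiv_right (m := 1) (by norm_num)).differentiableAt (by simp)
  refine Finset.sum_congr rfl fun i _ => ?_
  rw [fderiv_clm_apply hd (differentiableAt_const _), iteratedFDeriv_two_apply]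
  simp

theorem fderiv_comp_isometry {E : Type*} [NormedAddCommGroup E] [InnerProductSpace ℝ E]
    (g : E → ℝ) (L : E ≃ₗᵢ[ℝ] E) (a b : E) :
    fderiv ℝ (fun z => g (b + L (z - a))) a = (fderiv ℝ g b).comp (L : E →L[ℝ] E) := by
  have h1 := L.toContinuousLinearEquiv.comp_right_fderiv (f := fun z => g (b + z)) (x := 0)
  rw [fderiv_comp_sub a (f := fun z => g (b + L z)), sub_self]
  erw [h1]
  rw [fderiv_comp_add_left]
  simp only [map_zero, add_zero]

section Eigenspace

variable {n : ℕ} {M : Type*} [TopologicalSpace M] [ChartedSpace (EuclideanSpace ℝ (Fin n)) M]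

/-- Near `x` and `q`, the function `f'` is obtained from `f` by a change of coordinates which is the
affine isometry with linear part `L` sending the coordinates of `x` to those of `q`. -/
def IsIsometricPullback (f' f : C^∞⟮𝓡 n, M; 𝓘(ℝ, ℝ), ℝ⟯) (x q : M)
    (L : EuclideanSpace ℝ (Fin n) ≃ₗᵢ[ℝ] EuclideanSpace ℝ (Fin n)) : Prop :=
  localRep f' x =ᶠ[𝓝 (chartAt (EuclideanSpace ℝ (Fin n)) x x)] fun z =>
    localRep f q (chartAt (EuclideanSpace ℝ (Fin n)) q q +
      L (z - chartAt (EuclideanSpace ℝ (Fin n)) x x))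

theorem IsIsometricPullback.jet_eq {f' f : C^∞⟮𝓡 n, M; 𝓘(ℝ, ℝ), ℝ⟯} {x q : M}
    {L : EuclideanSpace ℝ (Fin n) ≃ₗᵢ[ℝ] EuclideanSpace ℝ (Fin n)}
    (h : IsIsometricPullback f' f x q L) :
    jet f' x (chartAt (EuclideanSpace ℝ (Fin n)) x x) =
      ((jet f q (chartAt (EuclideanSpace ℝ (Fin n)) q q)).1,
        (jet f q (chartAt (EuclideanSpace ℝ (Fin n)) q q)).2.comp
          (L : _ →L[ℝ] EuclideanSpace ℝ (Fin n))) := by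
  refine Prod.ext ?_ ?_
  · have := h.eq_of_nhds
    simpa [jet] using this
  · simp only [jet]
    rw [h.fderiv_eq, fderiv_comp_isometry]

variable [IsManifold (𝓡 n) ∞ M]

/-- The metric `g` has the property that its Laplace–Beltrami operator at `x` is the flat Laplacian
in the chart `chartAt x`. -/
def IsFlatAtCenters (g : Bundle.RiemannianMetric (fun p : M => TangentSpace (𝓡 n) p)) : Prop :=
  ∀ (f : C^∞⟮𝓡 n, M; 𝓘(ℝ, ℝ), ℝ⟯) (x : M),
    laplaceBeltrami g f x = Δ (localRep f x) (chartAt (EuclideanSpace ℝ (Fin n)) x x)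

variable {g : Bundle.RiemannianMetric (fun p : M => TangentSpace (𝓡 n) p)}

/-- The eigenspace `𝓔_Λ` as a linear subspace. -/
def IsFlatAtCenters.eigenspace (hg : IsFlatAtCenters g) (Λ : ℝ) :
    Submodule ℝ C^∞⟮𝓡 n, M; 𝓘(ℝ, ℝ), ℝ⟯ :=
  have hd : ∀ (f : C^∞⟮𝓡 n, M; 𝓘(ℝ, ℝ), ℝ⟯) (x : M),
      ContDiffAt ℝ 2 (localRep f x) (chartAt (EuclideanSpace ℝ (Fin n)) x x) := fun f x =>
    contDiffAt_infty.1 (contDiffAt_localRep f (mem_chart_target _ x)) 2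
  { carrier := laplaceEigenspace g Λ
    add_mem' := by
      intro f f' hf hf' x
      have h1 := hf x
      have h2 := hf' x
      rw [hg] at h1 h2 ⊢
      rw [localRep_add, (hd f x).laplacian_add (hd f' x), ContMDiffMap.coe_add, Pi.add_apply]
      linarith
    zero_mem' := by
      intro x
      rw [hg]
      have : localRep (0 : C^∞⟮𝓡 n, M; 𝓘(ℝ, ℝ), ℝ⟯) x = fun _ => 0 := rfl
      rw [this]
      simp
    smul_mem' := by
      intro c f hf x
      have h1 := hf x
      rw [hg] at h1 ⊢
      rw [localRep_smul, InnerProductSpace.laplacian_smul c (hd f x), ContMDiffMap.coe_smul,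
        Pi.smul_apply, smul_eq_mul, smul_eq_mul]
      linear_combination c * h1 }

/-- A function which is near every point an isometric pullback of an eigenfunction is an
eigenfunction. -/
theorem IsFlatAtCenters.mem_eigenspace_of_pullback (hg : IsFlatAtCenters g) {Λ : ℝ}
    {f f' : C^∞⟮𝓡 n, M; 𝓘(ℝ, ℝ), ℝ⟯} (hf : f ∈ hg.eigenspace Λ)
    (h : ∀ x, ∃ q L, IsIsometricPullback f' f x q L) : f' ∈ hg.eigenspace Λ := by
  intro x
  obtain ⟨q, L, hL⟩ := h x
  have hval : f' x = f q := by
    have := congrArg Prod.fst hL.jet_eq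
    simpa [jet, localRep_chartAt] using this
  rw [hg, (InnerProductSpace.laplacian_congr_nhds hL).eq_of_nhds, laplacian_comp_isometry, ← hg,
    hval]
  exact hf q

/-- An eigenfunction for a nonzero eigenvalue has a nonzero differential somewhere. -/
theorem IsFlatAtCenters.exists_fderiv_ne_zero (hg : IsFlatAtCenters g) {Λ : ℝ} (hΛ : Λ ≠ 0)
    {f : C^∞⟮𝓡 n, M; 𝓘(ℝ, ℝ), ℝ⟯} (hf : f ∈ hg.eigenspace Λ) {x : M} (hx : f x ≠ 0) :
    ∃ p, fderiv ℝ (localRep f p) (chartAt (EuclideanSpace ℝ (Fin n)) p p) ≠ 0 := by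
  by_contra! h
  set φ := chartAt (EuclideanSpace ℝ (Fin n)) x with hφ
  have h0 : fderiv ℝ (localRep f x) =ᶠ[𝓝 (φ x)] fun _ => 0 := by
    filter_upwards [φ.open_target.mem_nhds (mem_chart_target _ x)] with y hy
    have hq : φ.symm y ∈ φ.source := φ.map_target hy
    have h1 := (surjective_mvfderiv_iff f hq).not.1 <|
      (surjective_mvfderiv_iff f (mem_chart_source _ (φ.symm y))).not.2 (not_not.2 (h _))
    rw [not_not, ← hφ, φ.right_inv hy] at h1
    exact h1
  have h2 : Δ (localRep f x) (φ x) = 0 := by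
    rw [InnerProductSpace.laplacian_eq_iteratedFDeriv_stdOrthonormalBasis]
    simp [iteratedFDeriv_two_apply, h0.fderiv_eq]
  have h3 := hf x
  rw [hg, h2, neg_zero] at h3
  exact mul_ne_zero hΛ hx h3.symm

/-- On a compact manifold on which the isometries move every point to every other one and include,
at each point, the coordinate reflections, the eigenfunctions with regular nodal set are open and
dense. -/
theorem IsFlatAtCenters.isOpen_and_dense [CompactSpace M] (hg : IsFlatAtCenters g) {Λ : ℝ}
    (hΛ : Λ ≠ 0) (heig : IsLaplaceEigenvalue g Λ)
    (htrans : ∀ p q : M, ∀ f ∈ hg.eigenspace Λ, ∃ f' ∈ hg.eigenspace Λ, ∃ L,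
      IsIsometricPullback f' f p q L)
    (hrefl : ∀ p : M, ∀ u ∈ coordinateRoots n, ∀ f ∈ hg.eigenspace Λ, ∃ f' ∈ hg.eigenspace Λ,
      IsIsometricPullback f' f p p (ℝ ∙ u)ᗮ.reflection) {r : ℕ} (hr : 1 ≤ r) :
    IsOpen[eigenspaceTopology g Λ r] {f : laplaceEigenspace g Λ | HasRegularNodalSet f.1} ∧
      @Dense _ (eigenspaceTopology g Λ r)
        {f : laplaceEigenspace g Λ | HasRegularNodalSet f.1} := by
  -- some eigenfunction does not vanish at `x`, and has a nonzero differential at `q`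
  obtain ⟨f, hf, x, hx⟩ := heig
  obtain ⟨q, hq⟩ := hg.exists_fderiv_ne_zero hΛ hf hx
  refine isOpen_and_dense_hasRegularNodalSet (E := hg.eigenspace Λ) (fun p => ?_) hr
  refine realisesJets_of_reflections ?_ ?_ fun u hu f hf => ?_
  · obtain ⟨f', hf', L, hL⟩ := htrans p x f hf
    refine ⟨f', hf', ?_⟩
    have := congrArg Prod.fst hL.jet_eq
    simp only [jet, localRep_chartAt, mem_chart_source] at this
    rwa [this]
  · obtain ⟨f', hf', L, hL⟩ := htrans p q f hf
    refine ⟨f', hf', fun h0 => hq ?_⟩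
    have := congrArg Prod.snd hL.jet_eq
    simp only [jet, h0] at this
    ext v
    simpa using (DFunLike.congr_fun this (L.symm v)).symm
  · obtain ⟨f', hf', hL⟩ := hrefl p u hu f hf
    exact ⟨f', hf', hL.jet_eq⟩

end Eigenspace

/-! ### The flat torus -/

section Torus

variable {n : ℕ}

instance torusCompactSpace : CompactSpace (FlatTorus n) := by
  let F : (Fin n → Icc (0 : ℝ) (2 * Real.pi)) → FlatTorus n := fun t =>
    torusProj n (WithLp.toLp 2 fun i => (t i : ℝ))
  have hF : Continuous F := (torusProj_isLocalHomeomorph n).continuous.comp <|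
    (PiLp.continuous_toLp 2 _).comp <| continuous_pi fun i =>
      continuous_subtype_val.comp (continuous_apply i)
  refine ⟨?_⟩
  have : range F = univ := by
    refine eq_univ_of_forall fun p => ?_
    obtain ⟨z, rfl⟩ := torusProj_surjective n p
    have hpi := Real.two_pi_pos
    have hz : ∀ i, z i - 2 * Real.pi * ⌊z i / (2 * Real.pi)⌋ ∈ Icc (0 : ℝ) (2 * Real.pi) := by
      intro i
      have h1 := Int.floor_le (z i / (2 * Real.pi))
      have h2 := (Int.lt_floor_add_one (z i / (2 * Real.pi))).le
      rw [le_div_iff₀ hpi] at h1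
      rw [div_le_iff₀ hpi] at h2
      constructor <;> nlinarith
    refine ⟨fun i => ⟨_, hz i⟩, QuotientAddGroup.eq.2 ⟨fun i => ⌊z i / (2 * Real.pi)⌋, fun i => ?_⟩⟩
    simp
  rw [← this]
  exact isCompact_range hF

theorem torusProj_eq_iff {z w : EuclideanSpace ℝ (Fin n)} :
    torusProj n z = torusProj n w ↔ w - z ∈ torusLattice n := by
  rw [sub_eq_neg_add]
  exact QuotientAddGroup.eq

theorem torus_chartAt_symm (x : FlatTorus n) :
    ⇑(chartAt (EuclideanSpace ℝ (Fin n)) x).symm = torusProj n :=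
  (torusProj_isLocalHomeomorph n).localInverseAt_symm _

theorem torusProj_chartAt {x p : FlatTorus n}
    (hp : p ∈ (chartAt (EuclideanSpace ℝ (Fin n)) x).source) :
    torusProj n (chartAt (EuclideanSpace ℝ (Fin n)) x p) = p := by
  rw [← torus_chartAt_symm x]
  exact (chartAt (EuclideanSpace ℝ (Fin n)) x).left_inv hp

theorem torus_localRep (f : C^∞⟮𝓡 n, FlatTorus n; 𝓘(ℝ, ℝ), ℝ⟯) (x : FlatTorus n) :
    localRep f x = f ∘ torusProj n := by
  rw [localRep, torus_chartAt_symm]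

theorem metricMatrix_flatMetric (x : FlatTorus n) (y : EuclideanSpace ℝ (Fin n)) :
    metricMatrix (flatMetric n) x y = 1 := by
  have h : ∀ h : EuclideanSpace ℝ (Fin n) → FlatTorus n, h = torusProj n →
      ∀ v w : TangentSpace (𝓡 n) y,
      (flatMetric n).inner (h y) (mfderiv (𝓡 n) (𝓡 n) h y v) (mfderiv (𝓡 n) (𝓡 n) h y w) =
        inner ℝ (show EuclideanSpace ℝ (Fin n) from v) (show EuclideanSpace ℝ (Fin n) from w) := by
    rintro _ rfl v w
    exact flatMetric_torusProj n y v w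
  ext i j
  refine (h _ (torus_chartAt_symm x) _ _).trans ?_
  simp [basisVector, EuclideanSpace.inner_single_left, Matrix.one_apply]

theorem isFlatAtCenters_flatMetric : IsFlatAtCenters (flatMetric n) := by
  intro f x
  rw [← sum_fderiv_fderiv_eq_laplacian
    (contDiffAt_infty.1 (contDiffAt_localRep f (mem_chart_target _ x)) 2)]
  have hG : ∀ i y, gradientComponent (flatMetric n) f x i y =
      fderiv ℝ (localRep f x) y (EuclideanSpace.single i 1) := by
    intro i y
    simp [gradientComponent, metricMatrix_flatMetric, Matrix.one_apply, localRep]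
  simp [laplaceBeltrami, volumeDensity, metricMatrix_flatMetric, hG]

theorem contMDiff_of_contDiff_comp_torusProj {h : FlatTorus n → ℝ}
    (hh : ContDiff ℝ ∞ (h ∘ torusProj n)) : ContMDiff (𝓡 n) 𝓘(ℝ, ℝ) ∞ h := by
  intro x
  have h1 : ContMDiffAt (𝓡 n) 𝓘(ℝ, ℝ) ∞
      ((h ∘ torusProj n) ∘ chartAt (EuclideanSpace ℝ (Fin n)) x) x :=
    hh.contMDiff.contMDiffAt.comp x
      ((contMDiffOn_chart (I := 𝓡 n)).contMDiffAt (chart_source_mem_nhds _ x))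
  refine h1.congr_of_eventuallyEq ?_
  filter_upwards [chart_source_mem_nhds (EuclideanSpace ℝ (Fin n)) x] with p hp
  simp [torusProj_chartAt hp]

theorem contDiff_comp_torusProj (f : C^∞⟮𝓡 n, FlatTorus n; 𝓘(ℝ, ℝ), ℝ⟯) :
    ContDiff ℝ ∞ (f ∘ torusProj n) := by
  rw [contDiff_iff_contDiffAt]
  intro z
  set x := torusProj n z with hx
  have h1 := contDiffAt_localRep f (mem_chart_target (EuclideanSpace ℝ (Fin n)) x)
  rw [torus_localRep] at h1
  set k := chartAt (EuclideanSpace ℝ (Fin n)) x x - z with hk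
  have hkL : k ∈ torusLattice n := by
    rw [hk, ← torusProj_eq_iff, torusProj_chartAt (mem_chart_source _ x)]
  have h2 : f ∘ torusProj n = (f ∘ torusProj n) ∘ fun w => w + k := by
    ext w
    exact congrArg f (torusProj_eq_iff.2 (by simpa using hkL))
  rw [h2]
  refine ContDiffAt.comp z ?_ (by fun_prop)
  simpa [hk] using h1

/-- Translations and linear isometries preserving the lattice act on functions on the torus: `f'` is
the composition of `f` with the isometry of the torus taking `p` to `q` with differential `L`. -/
theorem exists_torus_pullback (f : C^∞⟮𝓡 n, FlatTorus n; 𝓘(ℝ, ℝ), ℝ⟯) (p q : FlatTorus n)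
    (L : EuclideanSpace ℝ (Fin n) ≃ₗᵢ[ℝ] EuclideanSpace ℝ (Fin n))
    (hL : ∀ v ∈ torusLattice n, L v ∈ torusLattice n) :
    ∃ f' : C^∞⟮𝓡 n, FlatTorus n; 𝓘(ℝ, ℝ), ℝ⟯, IsIsometricPullback f' f p q L ∧
      ∀ x, ∃ q', IsIsometricPullback f' f x q' L := by
  set a := chartAt (EuclideanSpace ℝ (Fin n)) p p with ha
  set b := chartAt (EuclideanSpace ℝ (Fin n)) q q with hb
  -- the choice of a representative of `x` in `ℝ^n` is immaterial, as `L` preserves the lattice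
  let h : FlatTorus n → ℝ := fun x =>
    f (torusProj n (b + L (Function.surjInv (torusProj_surjective n) x - a)))
  have hh : h ∘ torusProj n = fun z => (f ∘ torusProj n) (b + L (z - a)) := by
    ext z
    refine congrArg f (torusProj_eq_iff.2 ?_)
    have h1 := hL _ (torusProj_eq_iff.1
      (Function.surjInv_eq (torusProj_surjective n) (torusProj n z)))
    convert h1 using 1
    rw [add_sub_add_left_eq_sub, ← map_sub, sub_sub_sub_cancel_right]
  have hsmooth : ContDiff ℝ ∞ (h ∘ torusProj n) := by
    rw [hh]
    exact (contDiff_comp_torusProj f).comp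
      (contDiff_const.add (L.contDiff.comp (contDiff_id.sub contDiff_const)))
  let f' : C^∞⟮𝓡 n, FlatTorus n; 𝓘(ℝ, ℝ), ℝ⟯ := ⟨h, contMDiff_of_contDiff_comp_torusProj hsmooth⟩
  refine ⟨f', ?_, fun x => ?_⟩
  · refine Eventually.of_forall fun z => ?_
    rw [torus_localRep, torus_localRep]
    exact congrFun hh z
  · set c := chartAt (EuclideanSpace ℝ (Fin n)) x x with hc
    set q' := torusProj n (b + L (c - a)) with hq'
    refine ⟨q', Eventually.of_forall fun z => ?_⟩
    rw [torus_localRep, torus_localRep]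
    refine (congrFun hh z).trans (congrArg f (torusProj_eq_iff.2 ?_))
    have h1 : torusProj n (b + L (c - a)) =
        torusProj n (chartAt (EuclideanSpace ℝ (Fin n)) q' q') := by
      rw [torusProj_chartAt (mem_chart_source _ q')]
    convert torusProj_eq_iff.1 h1 using 1
    simp only [map_sub, ← hc]
    abel

/-- The reflections in the `coordinateRoots` preserve the lattice. -/
theorem reflection_mem_torusLattice {u : EuclideanSpace ℝ (Fin n)} (hu : u ∈ coordinateRoots n)
    {v : EuclideanSpace ℝ (Fin n)} (hv : v ∈ torusLattice n) :
    (ℝ ∙ u)ᗮ.reflection v ∈ torusLattice n := by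
  obtain ⟨k, hk⟩ := hv
  rw [Submodule.reflection_orthogonal_apply, Submodule.reflection_singleton_apply]
  rcases hu with ⟨i, rfl⟩ | ⟨i, j, hij, rfl⟩
  · refine ⟨k - Pi.single i (2 * k i), fun l => ?_⟩
    rcases eq_or_ne l i with rfl | hl
    · simp [hk, EuclideanSpace.inner_single_left]
      ring
    · simp [hk, EuclideanSpace.inner_single_left, hl]
  · have hn : ‖(EuclideanSpace.single i 1 - EuclideanSpace.single j 1 : EuclideanSpace ℝ (Fin n))‖ ^ 2
        = 2 := by
      rw [norm_sub_sq_real]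
      simp [EuclideanSpace.inner_single_left, hij]
      norm_num
    -- the reflection in `e_i - e_j` exchanges the `i`-th and the `j`-th coordinate
    refine ⟨k - Pi.single i (k i - k j) + Pi.single j (k i - k j), fun l => ?_⟩
    simp only [RCLike.ofReal_real_eq_id, id_eq, hn]
    rcases eq_or_ne l i with rfl | hl
    · simp [hk, EuclideanSpace.inner_single_left, inner_sub_left, hij]
      ring
    · rcases eq_or_ne l j with rfl | hl'
      · simp [hk, EuclideanSpace.inner_single_left, inner_sub_left, hl]
        ring
      · simp [hk, EuclideanSpace.inner_single_left, inner_sub_left, hl, hl']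

theorem isOpen_and_dense_torus {Λ : ℝ} (hΛ : Λ ≠ 0) (heig : IsLaplaceEigenvalue (flatMetric n) Λ)
    {r : ℕ} (hr : 1 ≤ r) :
    IsOpen[eigenspaceTopology (flatMetric n) Λ r]
        {f : laplaceEigenspace (flatMetric n) Λ | HasRegularNodalSet f.1} ∧
      @Dense _ (eigenspaceTopology (flatMetric n) Λ r)
        {f : laplaceEigenspace (flatMetric n) Λ | HasRegularNodalSet f.1} := by
  refine isFlatAtCenters_flatMetric.isOpen_and_dense hΛ heig (fun p q f hf => ?_)
    (fun p u hu f hf => ?_) hr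
  · obtain ⟨f', h1, h2⟩ := exists_torus_pullback f p q (LinearIsometryEquiv.refl ℝ _)
      fun v hv => hv
    exact ⟨f', isFlatAtCenters_flatMetric.mem_eigenspace_of_pullback hf
      fun x => (h2 x).imp fun q' h => ⟨_, h⟩, _, h1⟩
  · obtain ⟨f', h1, h2⟩ := exists_torus_pullback f p p (ℝ ∙ u)ᗮ.reflection
      fun v hv => reflection_mem_torusLattice hu hv
    exact ⟨f', isFlatAtCenters_flatMetric.mem_eigenspace_of_pullback hf
      fun x => (h2 x).imp fun q' h => ⟨_, h⟩, h1⟩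

end Torus

/-! ### The round sphere -/

section Sphere

variable {n : ℕ}

/-- The linear isometry from `ℝ^n` onto the orthogonal complement of `p` which underlies the
stereographic chart `chartAt p`. -/
def sphereFrame (p : RoundSphere n) :
    EuclideanSpace ℝ (Fin n) →ₗᵢ[ℝ] EuclideanSpace ℝ (Fin (n + 1)) :=
  have := Fact.mk (@finrank_euclideanSpace_fin ℝ _ (n + 1))
  (ℝ ∙ ((-p : RoundSphere n) : EuclideanSpace ℝ (Fin (n + 1))))ᗮ.subtypeₗᵢ.comp
    (OrthonormalBasis.fromOrthogonalSpanSingleton n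
      (ne_zero_of_mem_unit_sphere (-p))).repr.symm.toLinearIsometry

theorem inner_sphereFrame (p : RoundSphere n) (y : EuclideanSpace ℝ (Fin n)) :
    ⟪(p : EuclideanSpace ℝ (Fin (n + 1))), sphereFrame p y⟫_ℝ = 0 := by
  have h := Submodule.mem_orthogonal_singleton_iff_inner_right.1
    (show sphereFrame p y ∈
      (ℝ ∙ ((-p : RoundSphere n) : EuclideanSpace ℝ (Fin (n + 1))))ᗮ from Subtype.property _)
  simpa using h

theorem exists_sphereFrame_eq (p : RoundSphere n) {w : EuclideanSpace ℝ (Fin (n + 1))}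
    (hw : ⟪(p : EuclideanSpace ℝ (Fin (n + 1))), w⟫_ℝ = 0) : ∃ y, sphereFrame p y = w := by
  have := Fact.mk (@finrank_euclideanSpace_fin ℝ _ (n + 1))
  have h : w ∈ (ℝ ∙ ((-p : RoundSphere n) : EuclideanSpace ℝ (Fin (n + 1))))ᗮ :=
    Submodule.mem_orthogonal_singleton_iff_inner_right.2 (by simpa using hw)
  refine ⟨(OrthonormalBasis.fromOrthogonalSpanSingleton n
      (ne_zero_of_mem_unit_sphere (-p))).repr ⟨w, h⟩, ?_⟩
  exact congrArg Subtype.val (LinearIsometryEquiv.symm_apply_apply _ _)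

theorem sphere_chartAt_target (p : RoundSphere n) :
    (chartAt (EuclideanSpace ℝ (Fin n)) p).target = univ := by
  have := Fact.mk (@finrank_euclideanSpace_fin ℝ _ (n + 1))
  exact stereographic'_target (-p)

theorem sphere_chartAt_symm (p : RoundSphere n) (y : EuclideanSpace ℝ (Fin n)) :
    ((chartAt (EuclideanSpace ℝ (Fin n)) p).symm y : EuclideanSpace ℝ (Fin (n + 1))) =
      (4 * (‖y‖ ^ 2 + 4)⁻¹) • sphereFrame p y +
        (8 * (‖y‖ ^ 2 + 4)⁻¹ - 1) • (p : EuclideanSpace ℝ (Fin (n + 1))) := by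
  have := Fact.mk (@finrank_euclideanSpace_fin ℝ _ (n + 1))
  have h1 : ‖y‖ ^ 2 + 4 ≠ 0 := by positivity
  have h := stereographic'_symm_apply (-p) y
  refine h.trans ?_
  have h2 : ∀ w : (ℝ ∙ ((-p : RoundSphere n) : EuclideanSpace ℝ (Fin (n + 1))))ᗮ,
    ‖(w : EuclideanSpace ℝ (Fin (n + 1)))‖ = ‖w‖ := fun w => rfl
  simp only [h2, LinearIsometryEquiv.norm_map]
  rw [smul_smul, smul_smul, mul_comm 4]
  congr 1
  change _ • (-(p : EuclideanSpace ℝ (Fin (n + 1)))) = _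
  rw [smul_neg, ← neg_smul]
  congr 1
  field_simp
  ring

theorem sphere_chartAt_self (p : RoundSphere n) :
    chartAt (EuclideanSpace ℝ (Fin n)) p p = 0 := by
  have h : (chartAt (EuclideanSpace ℝ (Fin n)) p).symm 0 = p := by
    ext1
    rw [sphere_chartAt_symm]
    norm_num
  have h0 := (chartAt (EuclideanSpace ℝ (Fin n)) p).right_inv
    (show (0 : EuclideanSpace ℝ (Fin n)) ∈ _ by rw [sphere_chartAt_target]; exact mem_univ _)
  rwa [h] at h0

/-- The stereographic chart is conformal, with conformal factor `4 / (‖y‖ ^ 2 + 4)`. -/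
theorem metricMatrix_roundMetric (p : RoundSphere n) (y : EuclideanSpace ℝ (Fin n)) :
    metricMatrix (roundMetric n) p y = ((4 * (‖y‖ ^ 2 + 4)⁻¹) ^ 2) • 1 := by
  have := Fact.mk (@finrank_euclideanSpace_fin ℝ _ (n + 1))
  set φ := chartAt (EuclideanSpace ℝ (Fin n)) p with hφ
  set ι : EuclideanSpace ℝ (Fin n) → EuclideanSpace ℝ (Fin (n + 1)) := fun y => φ.symm y with hι
  have hy : y ∈ φ.target := by rw [hφ, sphere_chartAt_target]; exact mem_univ y
  have hM : φ.MDifferentiable (𝓡 n) (𝓡 n) := mdifferentiable_chart p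
  have hchain : ∀ v : EuclideanSpace ℝ (Fin n), mvfderiv (𝓡 n)
      ((↑) : RoundSphere n → EuclideanSpace ℝ (Fin (n + 1))) (φ.symm y)
        (mfderiv (𝓡 n) (𝓡 n) φ.symm y v) = fderiv ℝ ι y v := by
    intro v
    have hc : MDifferentiableAt (𝓡 n) 𝓘(ℝ, EuclideanSpace ℝ (Fin (n + 1)))
        ((↑) : RoundSphere n → EuclideanSpace ℝ (Fin (n + 1))) (φ.symm y) :=
      (contMDiff_coe_sphere (m := 1) _).mdifferentiableAt (by simp)
    have := mfderiv_comp (I' := 𝓡 n) y hc (hM.symm.mdifferentiableAt hy)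
    rw [← mfderiv_eq_fderiv]
    exact (DFunLike.congr_fun this v).symm
  have hs : ‖y‖ ^ 2 + 4 ≠ 0 := by positivity
  have hinv : HasFDerivAt (fun z : EuclideanSpace ℝ (Fin n) => (‖z‖ ^ 2 + 4)⁻¹)
      (-((‖y‖ ^ 2 + 4) ^ 2)⁻¹ • (2 • innerSL ℝ y)) y :=
    (hasDerivAt_inv hs).comp_hasFDerivAt y
      ((hasStrictFDerivAt_norm_sq y).hasFDerivAt.add_const 4)
  have hder : ∀ v : EuclideanSpace ℝ (Fin n), fderiv ℝ ι y v =
      (4 * (‖y‖ ^ 2 + 4)⁻¹) • sphereFrame p v -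
        (8 * ⟪y, v⟫_ℝ * ((‖y‖ ^ 2 + 4) ^ 2)⁻¹) • sphereFrame p y -
        (16 * ⟪y, v⟫_ℝ * ((‖y‖ ^ 2 + 4) ^ 2)⁻¹) • (p : EuclideanSpace ℝ (Fin (n + 1))) := by
    intro v
    have h1 : ι = fun z => (4 * (‖z‖ ^ 2 + 4)⁻¹) • sphereFrame p z +
        (8 * (‖z‖ ^ 2 + 4)⁻¹ - 1) • (p : EuclideanSpace ℝ (Fin (n + 1))) :=
      funext fun z => sphere_chartAt_symm p z
    have h2 := ((hinv.const_mul 4).smul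
      (sphereFrame p).toContinuousLinearMap.hasFDerivAt).add
      (((hinv.const_mul 8).sub_const 1).smul_const (p : EuclideanSpace ℝ (Fin (n + 1))))
    rw [h1]
    erw [h2.fderiv]
    simp
    module
  have hpp : ⟪(p : EuclideanSpace ℝ (Fin (n + 1))), p⟫_ℝ = 1 := by
    simp
  have hpf := inner_sphereFrame p
  have hfp : ∀ z, ⟪sphereFrame p z, (p : EuclideanSpace ℝ (Fin (n + 1)))⟫_ℝ = 0 := fun z => by
    rw [real_inner_comm]; exact hpf z
  have hmain : ∀ v w : EuclideanSpace ℝ (Fin n), ⟪fderiv ℝ ι y v, fderiv ℝ ι y w⟫_ℝ =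
      (4 * (‖y‖ ^ 2 + 4)⁻¹) ^ 2 * ⟪v, w⟫_ℝ := by
    intro v w
    rw [hder, hder]
    simp only [inner_sub_left, inner_sub_right, real_inner_smul_left, real_inner_smul_right, hpf,
      hfp, hpp, (sphereFrame p).inner_map_map, real_inner_self_eq_norm_sq, real_inner_comm y v]
    field_simp
    ring
  ext i j
  change ⟪mvfderiv (𝓡 n) ((↑) : RoundSphere n → EuclideanSpace ℝ (Fin (n + 1))) (φ.symm y)
        (mfderiv (𝓡 n) (𝓡 n) φ.symm y (EuclideanSpace.single i (1 : ℝ))),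
      mvfderiv (𝓡 n) ((↑) : RoundSphere n → EuclideanSpace ℝ (Fin (n + 1))) (φ.symm y)
        (mfderiv (𝓡 n) (𝓡 n) φ.symm y (EuclideanSpace.single j (1 : ℝ)))⟫_ℝ = _
  rw [hchain, hchain, hmain]
  simp [EuclideanSpace.inner_single_left, Matrix.one_apply]

/-- The conformal factor of the stereographic chart is critical at the centre, where it is `1`, so
that there the Laplace–Beltrami operator is the flat Laplacian. -/
theorem isFlatAtCenters_roundMetric : IsFlatAtCenters (roundMetric n) := by
  intro f x
  have hF := contDiffAt_infty.1 (contDiffAt_localRep f (mem_chart_target _ x)) 2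
  rw [← sum_fderiv_fderiv_eq_laplacian hF]
  rw [sphere_chartAt_self] at hF ⊢
  let ρ : EuclideanSpace ℝ (Fin n) → ℝ := fun y => 4 * (‖y‖ ^ 2 + 4)⁻¹
  have hρ : ∀ y, 0 < ρ y := fun y => by positivity
  have hV : ∀ y, volumeDensity (roundMetric n) x y = ρ y ^ n := by
    intro y
    rw [volumeDensity, metricMatrix_roundMetric, Matrix.det_smul, Matrix.det_one, mul_one,
      Fintype.card_fin, pow_right_comm]
    exact Real.sqrt_sq (pow_nonneg (hρ y).le n)
  have hG : ∀ i y, gradientComponent (roundMetric n) f x i y =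
      (ρ y ^ 2)⁻¹ * fderiv ℝ (localRep f x) y (EuclideanSpace.single i 1) := by
    intro i y
    have hinv : (ρ y ^ 2 • (1 : Matrix (Fin n) (Fin n) ℝ))⁻¹ = (ρ y ^ 2)⁻¹ • 1 := by
      refine Matrix.inv_eq_right_inv ?_
      have := (hρ y).ne'
      simp [smul_smul]
      field_simp
      simp
    rw [gradientComponent, metricMatrix_roundMetric, hinv]
    simp [Matrix.one_apply, localRep]
  -- `ρ ^ n * ρ ^ (-2)` is a function of `‖y‖ ^ 2`, hence critical at the origin
  have hμ : HasFDerivAt (fun y => ρ y ^ n * (ρ y ^ 2)⁻¹)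
      (0 : EuclideanSpace ℝ (Fin n) →L[ℝ] ℝ) 0 := by
    have h1 : DifferentiableAt ℝ (fun t : ℝ => (4 * (t + 4)⁻¹) ^ n * ((4 * (t + 4)⁻¹) ^ 2)⁻¹)
        (‖(0 : EuclideanSpace ℝ (Fin n))‖ ^ 2) := by
      have h2 : DifferentiableAt ℝ (fun t : ℝ => 4 * (t + 4)⁻¹)
          (‖(0 : EuclideanSpace ℝ (Fin n))‖ ^ 2) :=
        ((differentiableAt_id.add_const 4).inv (by norm_num)).const_mul 4
      exact (h2.pow n).mul ((h2.pow 2).inv (by norm_num))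
    have h3 := h1.hasDerivAt.comp_hasFDerivAt (0 : EuclideanSpace ℝ (Fin n))
      (hasStrictFDerivAt_norm_sq (0 : EuclideanSpace ℝ (Fin n))).hasFDerivAt
    exact h3.congr_fderiv (by simp)
  have hρ0 : ρ 0 = 1 := by simp [ρ]
  rw [laplaceBeltrami, sphere_chartAt_self]
  simp only [hV, hG, hρ0, ← mul_assoc]
  rw [one_pow, inv_one, one_mul]
  refine Finset.sum_congr rfl fun i _ => ?_
  have hd : DifferentiableAt ℝ (fun y => fderiv ℝ (localRep f x) y (EuclideanSpace.single i 1)) 0 :=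
    ((hF.fderiv_right (m := 1) (by norm_num)).differentiableAt (by simp)).clm_apply
      (differentiableAt_const _)
  refine (DFunLike.congr_fun (hμ.mul hd.hasFDerivAt).fderiv _).trans ?_
  simp [hρ0]

/-- Linear isometries of the ambient space act on functions on the sphere; in stereographic
coordinates they are linear isometries. -/
theorem exists_sphere_pullback (f : C^∞⟮𝓡 n, RoundSphere n; 𝓘(ℝ, ℝ), ℝ⟯)
    (A : EuclideanSpace ℝ (Fin (n + 1)) ≃ₗᵢ[ℝ] EuclideanSpace ℝ (Fin (n + 1))) :
    ∃ f' : C^∞⟮𝓡 n, RoundSphere n; 𝓘(ℝ, ℝ), ℝ⟯, ∀ (x q : RoundSphere n) (L),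
      A x = q → (∀ y, sphereFrame q (L y) = A (sphereFrame x y)) →
        IsIsometricPullback f' f x q L := by
  have := Fact.mk (@finrank_euclideanSpace_fin ℝ _ (n + 1))
  have hmem : ∀ x : RoundSphere n, A x ∈ Metric.sphere (0 : EuclideanSpace ℝ (Fin (n + 1))) 1 :=
    fun x => by simp
  have hA : ContMDiff (𝓡 n) (𝓡 n) ∞ (Set.codRestrict _ _ hmem : RoundSphere n → RoundSphere n) :=
    ContMDiff.codRestrict_sphere (A.contDiff.contMDiff.comp contMDiff_coe_sphere) hmem
  let f' : C^∞⟮𝓡 n, RoundSphere n; 𝓘(ℝ, ℝ), ℝ⟯ :=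
    ⟨f ∘ Set.codRestrict _ _ hmem, f.contMDiff.comp hA⟩
  refine ⟨f', fun x q L hq hL => Eventually.of_forall fun z => ?_⟩
  simp only [sphere_chartAt_self, zero_add, sub_zero]
  refine congrArg f ?_
  ext1
  change A ((chartAt (EuclideanSpace ℝ (Fin n)) x).symm z) = _
  rw [sphere_chartAt_symm, sphere_chartAt_symm]
  simp [hL, hq]

/-- The differential of a linear isometry `A` of the sphere at `x`, read in the frames at `x` and
at `A x`. -/
theorem exists_frame_isometry (A : EuclideanSpace ℝ (Fin (n + 1)) ≃ₗᵢ[ℝ]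
      EuclideanSpace ℝ (Fin (n + 1))) {x q : RoundSphere n} (hq : A x = q) :
    ∃ L : EuclideanSpace ℝ (Fin n) ≃ₗᵢ[ℝ] EuclideanSpace ℝ (Fin n),
      ∀ y, sphereFrame q (L y) = A (sphereFrame x y) := by
  have h : ∀ y, ∃ z, sphereFrame q z = A (sphereFrame x y) := fun y =>
    exists_sphereFrame_eq q (by rw [← hq, A.inner_map_map, inner_sphereFrame])
  choose L hL using h
  let L' : EuclideanSpace ℝ (Fin n) →ₗᵢ[ℝ] EuclideanSpace ℝ (Fin n) :=
    { toFun := L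
      map_add' := fun y z => (sphereFrame q).injective (by simp [hL])
      map_smul' := fun c y => (sphereFrame q).injective (by simp [hL])
      norm_map' := fun y => by
        change ‖L y‖ = ‖y‖
        rw [← (sphereFrame q).norm_map, hL, A.norm_map, (sphereFrame x).norm_map] }
  exact ⟨L'.toLinearIsometryEquiv rfl, hL⟩

theorem isOpen_and_dense_sphere {Λ : ℝ} (hΛ : Λ ≠ 0)
    (heig : IsLaplaceEigenvalue (roundMetric n) Λ) {r : ℕ} (hr : 1 ≤ r) :
    IsOpen[eigenspaceTopology (roundMetric n) Λ r]
        {f : laplaceEigenspace (roundMetric n) Λ | HasRegularNodalSet f.1} ∧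
      @Dense _ (eigenspaceTopology (roundMetric n) Λ r)
        {f : laplaceEigenspace (roundMetric n) Λ | HasRegularNodalSet f.1} := by
  have hinv : ∀ f ∈ isFlatAtCenters_roundMetric.eigenspace Λ,
      ∀ A : EuclideanSpace ℝ (Fin (n + 1)) ≃ₗᵢ[ℝ] EuclideanSpace ℝ (Fin (n + 1)),
      ∃ f' ∈ isFlatAtCenters_roundMetric.eigenspace Λ, ∀ (x q : RoundSphere n) (L),
        A x = q → (∀ y, sphereFrame q (L y) = A (sphereFrame x y)) →
          IsIsometricPullback f' f x q L := by
    intro f hf A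
    obtain ⟨f', h⟩ := exists_sphere_pullback f A
    refine ⟨f', isFlatAtCenters_roundMetric.mem_eigenspace_of_pullback hf fun x => ?_, h⟩
    have hq : A x = (⟨A x, by simp⟩ : RoundSphere n) := rfl
    obtain ⟨L, hL⟩ := exists_frame_isometry A hq
    exact ⟨_, L, h _ _ L hq hL⟩
  refine isFlatAtCenters_roundMetric.isOpen_and_dense hΛ heig (fun p q f hf => ?_)
    (fun p u _ f hf => ?_) hr
  · have hA := Submodule.reflection_sub (v := (p : EuclideanSpace ℝ (Fin (n + 1)))) (w := q)
      (by simp)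
    obtain ⟨f', hf', h⟩ := hinv f hf _
    obtain ⟨L, hL⟩ := exists_frame_isometry _ hA
    exact ⟨f', hf', L, h _ _ L hA hL⟩
  · obtain ⟨f', hf', h⟩ := hinv f hf (ℝ ∙ sphereFrame p u)ᗮ.reflection
    refine ⟨f', hf', h _ _ _ ?_ fun y => ?_⟩
    · refine Submodule.reflection_mem_subspace_eq_self
        (Submodule.mem_orthogonal_singleton_iff_inner_right.2 ?_)
      rw [real_inner_comm, inner_sphereFrame]
    · simp [Submodule.reflection_orthogonal_apply, Submodule.reflection_singleton_apply]

end Sphere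

end

theorem mainTheorem6 (n : ℕ) (hn : 1 ≤ n) (r : ℕ) (hr : 1 ≤ r) (Λ : ℝ) (hΛ : 0 < Λ) :
    (IsLaplaceEigenvalue (roundMetric n) Λ →
      IsOpen[eigenspaceTopology (roundMetric n) Λ r]
          {f : laplaceEigenspace (roundMetric n) Λ | HasRegularNodalSet f.1} ∧
        @Dense _ (eigenspaceTopology (roundMetric n) Λ r)
          {f : laplaceEigenspace (roundMetric n) Λ | HasRegularNodalSet f.1}) ∧
    (IsLaplaceEigenvalue (flatMetric n) Λ →
      IsOpen[eigenspaceTopology (flatMetric n) Λ r]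
          {f : laplaceEigenspace (flatMetric n) Λ | HasRegularNodalSet f.1} ∧
        @Dense _ (eigenspaceTopology (flatMetric n) Λ r)
          {f : laplaceEigenspace (flatMetric n) Λ | HasRegularNodalSet f.1}) := by
  exact ⟨fun h => isOpen_and_dense_sphere hΛ.ne' h hr, fun h => isOpen_and_dense_torus hΛ.ne' h hr⟩
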